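/- Let $P\subset\mathbb R^3$ be an integer polytope, i.e. the convex hull of finitely many points such that every vertex of $P$ has integer coordinates. Let $X$ be a random vector uniformly distributed on $[0,1]^3$, and for a bounded set $C\subset\mathbb R^3$ put $$X_C = |(C+X)\cap\mathbb Z^3|,$$ the number of integer points in the translate $C+X$ (the same $X$ is used for all $C$). Then for every positive integer $n$ the random variables $X_{nP}$ and $$Y_n=\frac{n(n+1)}{2}X_P-\frac{n(n-1)}{2}X_{-P}$$ are integrable, and $X_{nP}-\mathbb E X_{nP}=Y_n-\mathbb E Y_n$ almost surely. In particular, $X_{nP}-\frac{n(n+1)}{2}X_P+\frac{n(n-1)}{2}X_{-P}$ is almost surely constant. -/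

import Mathlib

open scoped Pointwise

/-- The set of integer points of `ℝ^d`, i.e. the lattice `ℤ^d` inside `ℝ^d`. -/
def integerPoints (d : ℕ) : Set (Fin d → ℝ) :=
  {x | ∀ i, ∃ m : ℤ, x i = (m : ℝ)}

/-- A (convex) polytope in `ℝ^d`: the convex hull of a finite set of points. -/
def IsPolytope {d : ℕ} (P : Set (Fin d → ℝ)) : Prop :=
  ∃ S : Set (Fin d → ℝ), S.Finite ∧ P = convexHull ℝ S

/-- An integer polytope: a polytope all of whose vertices (extreme points) are integer points. -/
def IsIntegerPolytope {d : ℕ} (P : Set (Fin d → ℝ)) : Prop :=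
  IsPolytope P ∧ P.extremePoints ℝ ⊆ integerPoints d

/-- The number `|(C + x) ∩ ℤ^d|` of integer points in the translate of `C` by `x`
(meaningful for bounded `C`, where the intersection is finite). -/
noncomputable def latticeCount {d : ℕ} (C : Set (Fin d → ℝ)) (x : Fin d → ℝ) : ℕ :=
  ((C + {x}) ∩ integerPoints d).ncard

/-- Equality up to an additive constant: `Y` and `Z` are integrable and
`Y - 𝔼 Y = Z - 𝔼 Z` almost surely. -/
def EqUpToConst {Ω : Type*} [MeasurableSpace Ω] (μ : MeasureTheory.Measure Ω) (Y Z : Ω → ℝ) :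
    Prop :=
  MeasureTheory.Integrable Y μ ∧ MeasureTheory.Integrable Z μ ∧
    ∀ᵐ ω ∂μ, Y ω - ∫ ω', Y ω' ∂μ = Z ω - ∫ ω', Z ω' ∂μ

/-! ### Regular triangulations from generic heights. -/

section Triangulation

variable {ι E : Type*} [Fintype ι] [NormedAddCommGroup E] [NormedSpace ℝ E]

/-! For a lattice simplex, translate one vertex to the origin and let the edge vectors form a basis
`b`. Sort the integer points by their class modulo the lattice spanned by `b`. In the translated
half-open parallelepiped each class has one representative `a`, and the number of classes does not
depend on the translation. Let `s` be the sum of the coordinates of `a - x`; almost surely they lie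
in `(0,1)` and `s ≠ 2`. The class meets the `n`-th dilate in as many points as there are `m ∈ ℕ³`
with `|m| + s ≤ n`, namely `C(n+2,3)`, `C(n+1,3)` or `C(n,3)` as `⌈s⌉` is 1, 2 or 3. Relative to the
middle value these differ by `n(n+1)/2` when `s ≤ 1` and by `-n(n-1)/2` when `s > 2`. Those two
events say exactly that the class contributes a point to the simplex, respectively to its
reflection. Summing over classes gives the relation, with constant `C(n+1,3)` times the number of
classes (`cornerSimplex_relation`).

The relation is linear in the counts, so it passes to any polytope cut, up to a null set, into
lattice simplices. `exists_ae_triangulation` gives such a cut without new vertices: lift the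
vertices to generic heights and project the lower faces of the lifted hull. Taking expectations then
removes the constant. -/

/-- The convex hull of finitely many points of a family is the set of their convex combinations,
written with weights on the whole index type. -/
lemma mem_convexHull_image_iff_exists_weights (p : ι → E) (s : Finset ι) (x : E) :
    x ∈ convexHull ℝ (p '' s) ↔ ∃ w : ι → ℝ, (∀ i, 0 ≤ w i) ∧ (∀ i ∉ s, w i = 0) ∧
      ∑ i, w i = 1 ∧ ∑ i, w i • p i = x := by
  classical
  constructor
  · intro hx
    refine convexHull_min (t := {x | ∃ w : ι → ℝ, (∀ i, 0 ≤ w i) ∧ (∀ i ∉ s, w i = 0) ∧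
      ∑ i, w i = 1 ∧ ∑ i, w i • p i = x}) ?_ ?_ hx
    · rintro _ ⟨i, hi, rfl⟩
      refine ⟨Pi.single i 1, fun j => ?_, fun j hj => ?_, by simp, ?_⟩
      · by_cases h : j = i
        · subst h; simp
        · simp [h]
      · have : j ≠ i := by rintro rfl; exact hj hi
        simp [this]
      · rw [Finset.sum_eq_single i] <;> simp +contextual
    · rintro _ ⟨w, hw0, hws, hw1, rfl⟩ _ ⟨w', hw0', hws', hw1', rfl⟩ a b ha hb hab
      refine ⟨fun i => a * w i + b * w' i, fun i => ?_, fun i hi => ?_, ?_, ?_⟩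
      · have := hw0 i; have := hw0' i; positivity
      · simp [hws i hi, hws' i hi]
      · rw [Finset.sum_add_distrib, ← Finset.mul_sum, ← Finset.mul_sum, hw1, hw1']; linarith
      · simp only [add_smul, mul_smul, Finset.sum_add_distrib, Finset.smul_sum]
  · rintro ⟨w, hw0, hws, hw1, rfl⟩
    have h1 : ∑ i, w i • p i = ∑ i ∈ s, w i • p i := by
      refine (Finset.sum_subset (Finset.subset_univ s) fun i _ hi => ?_).symm
      simp [hws i hi]
    have h2 : ∑ i ∈ s, w i = 1 := by
      rw [← hw1]
      exact Finset.sum_subset (Finset.subset_univ s) fun i _ hi => hws i hi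
    rw [h1]
    exact (convex_convexHull ℝ _).sum_mem (fun i _ => hw0 i) h2
      fun i hi => subset_convexHull ℝ _ ⟨i, hi, rfl⟩

lemma sum_mul_affineMap_apply (p : ι → E) (β : ι → ℝ) (h : E →ᵃ[ℝ] ℝ) :
    ∑ i, β i * h (p i) = h.linear (∑ i, β i • p i) + (∑ i, β i) * h 0 := by
  have key : ∀ x, h x = h.linear x + h 0 := fun x => by
    simpa using h.map_vadd 0 x
  simp only [map_sum, map_smul, smul_eq_mul, Finset.sum_mul, ← Finset.sum_add_distrib]
  exact Finset.sum_congr rfl fun i _ => by rw [key (p i)]; ring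

/-- A height function is generic if no affinely dependent subfamily of the lifted points is
explained by the affine dependence of the points below. -/
def IsGenericHeight (p : ι → E) (ω : ι → ℝ) : Prop :=
  ∀ s : Finset ι, ¬ AffineIndependent ℝ (fun i : s => p i) →
    ∃ β : ι → ℝ, (∀ i ∉ s, β i = 0) ∧ ∑ i, β i = 0 ∧ ∑ i, β i • p i = 0 ∧ ∑ i, β i * ω i ≠ 0

lemma exists_affine_dependence (p : ι → E) (s : Finset ι)
    (hs : ¬ AffineIndependent ℝ (fun i : s => p i)) :
    ∃ β : ι → ℝ, (∀ i ∉ s, β i = 0) ∧ ∑ i, β i = 0 ∧ ∑ i, β i • p i = 0 ∧ β ≠ 0 := by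
  classical
  rw [affineIndependent_iff_of_fintype] at hs
  push Not at hs
  obtain ⟨w, hw, hwp, i, hi⟩ := hs
  rw [Finset.univ.weightedVSub_eq_linear_combination hw] at hwp
  set β : ι → ℝ := fun i => if h : i ∈ s then w ⟨i, h⟩ else 0 with hβ
  have hβs : ∀ i : s, β i = w i := fun i => by simp [hβ]
  have hβn : ∀ i ∉ s, β i = 0 := fun i hi => by simp [hβ, hi]
  refine ⟨β, hβn, ?_, ?_, fun h0 => hi ?_⟩
  · rw [← Finset.sum_subset (Finset.subset_univ s) fun i _ hi => hβn i hi, ← Finset.sum_coe_sort]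
    simpa only [hβs] using hw
  · rw [← Finset.sum_subset (Finset.subset_univ s) fun i _ hi => by simp [hβn i hi],
      ← Finset.sum_coe_sort]
    simpa only [hβs] using hwp
  · rw [← hβs, h0]; rfl

/-- For each dependent subfamily fix one nonzero dependence. The heights it annihilates form a
proper subspace, and finitely many proper subspaces cannot cover a real vector space. -/
lemma exists_isGenericHeight (p : ι → E) : ∃ ω : ι → ℝ, IsGenericHeight p ω := by
  classical
  choose! β hβs hβ0 hβp hβne using exists_affine_dependence p
  let H : Finset ι → Subspace ℝ (ι → ℝ) := fun s =>
    LinearMap.ker (∑ i, β s i • (LinearMap.proj i : (ι → ℝ) →ₗ[ℝ] ℝ))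
  have hmem : ∀ s ω, ω ∈ H s ↔ ∑ i, β s i * ω i = 0 := fun s ω => by
    simp [H, LinearMap.mem_ker, LinearMap.sum_apply]
  let F : Finset (Subspace ℝ (ι → ℝ)) :=
    (Finset.univ.filter fun s : Finset ι => ¬ AffineIndependent ℝ (fun i : s => p i)).image H
  have hF : ⊤ ∉ F := by
    intro h
    obtain ⟨s, hs, hst⟩ := Finset.mem_image.1 h
    have hs' := (Finset.mem_filter.1 hs).2
    refine hβne s hs' (funext fun i => ?_)
    have := (hmem s (Pi.single i 1)).1 (by rw [hst]; trivial)
    simpa [Pi.single_apply] using this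
  have := Subspace.biUnion_ne_univ_of_top_notMem hF
  obtain ⟨ω, hω⟩ := (Set.ne_univ_iff_exists_notMem _).1 this
  refine ⟨ω, fun s hs => ⟨β s, hβs s hs, hβ0 s hs, hβp s hs, fun h => hω ?_⟩⟩
  simp only [Set.mem_iUnion]
  exact ⟨H s, Finset.mem_image_of_mem _ (by simpa using hs), (hmem s ω).2 h⟩

/-- A set of indices is a lower cell for the heights `ω` if some affine function below `ω` agrees
with `ω` exactly on it. -/
def IsLowerCell (p : ι → E) (ω : ι → ℝ) (s : Finset ι) : Prop :=
  ∃ h : E →ᵃ[ℝ] ℝ, ∀ i, h (p i) ≤ ω i ∧ (h (p i) = ω i ↔ i ∈ s)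

/-- On `s` the heights agree with an affine function, which every affine dependence annihilates;
genericity forbids this for a dependent `s`. -/
lemma IsLowerCell.affineIndependent {p : ι → E} {ω : ι → ℝ} (hω : IsGenericHeight p ω)
    {s : Finset ι} (hs : IsLowerCell p ω s) : AffineIndependent ℝ (fun i : s => p i) := by
  by_contra hd
  obtain ⟨β, hβs, hβ0, hβp, hne⟩ := hω s hd
  obtain ⟨h, hh⟩ := hs
  apply hne
  have : ∑ i, β i * ω i = ∑ i, β i * h (p i) := by
    refine Finset.sum_congr rfl fun i _ => ?_
    by_cases hi : i ∈ s
    · rw [(hh i).2.2 hi]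
    · simp [hβs i hi]
  rw [this, sum_mul_affineMap_apply, hβ0, hβp]; simp

/-- Each supporting function computes the cost of its own representation of `x` and bounds the cost
of the other from below. Both costs therefore agree, so the weights for `s` live only where the
function of `t` also touches `ω`. -/
lemma IsLowerCell.mem_convexHull_inter [DecidableEq ι] {p : ι → E} {ω : ι → ℝ} {s t : Finset ι}
    (hs : IsLowerCell p ω s) (ht : IsLowerCell p ω t) {x : E} (hxs : x ∈ convexHull ℝ (p '' s))
    (hxt : x ∈ convexHull ℝ (p '' t)) : x ∈ convexHull ℝ (p '' (s ∩ t : Finset ι)) := by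
  rw [mem_convexHull_image_iff_exists_weights] at hxs hxt ⊢
  obtain ⟨w, hw0, hws, hw1, hwx⟩ := hxs
  obtain ⟨w', hw0', hws', hw1', hwx'⟩ := hxt
  obtain ⟨h, hh⟩ := hs
  obtain ⟨h', hh'⟩ := ht
  have e1 : ∑ i, w i * ω i = ∑ i, w i * h (p i) := by
    refine Finset.sum_congr rfl fun i _ => ?_
    by_cases hi : i ∈ s
    · rw [(hh i).2.2 hi]
    · simp [hws i hi]
  have e2 : ∑ i, w' i * ω i = ∑ i, w' i * h' (p i) := by
    refine Finset.sum_congr rfl fun i _ => ?_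
    by_cases hi : i ∈ t
    · rw [(hh' i).2.2 hi]
    · simp [hws' i hi]
  have e3 : ∑ i, w' i * h (p i) ≤ ∑ i, w' i * ω i :=
    Finset.sum_le_sum fun i _ => mul_le_mul_of_nonneg_left (hh i).1 (hw0' i)
  have e4 : ∀ i ∈ Finset.univ, w i * h' (p i) ≤ w i * ω i :=
    fun i _ => mul_le_mul_of_nonneg_left (hh' i).1 (hw0 i)
  have e5 : ∑ i, w i * h' (p i) = ∑ i, w i * ω i := by
    refine le_antisymm (Finset.sum_le_sum e4) ?_
    rw [e1]
    rw [e2] at e3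
    simp only [sum_mul_affineMap_apply, hw1, hw1', hwx, hwx'] at e3 ⊢
    exact e3
  rw [Finset.sum_eq_sum_iff_of_le e4] at e5
  refine ⟨w, hw0, fun i hi => ?_, hw1, hwx⟩
  by_contra hne
  have his : i ∈ s := by_contra fun h => hne (hws i h)
  have hit : i ∈ t := (hh' i).2.1 (mul_left_cancel₀ hne (e5 i (Finset.mem_univ i)))
  exact hi (Finset.mem_inter.2 ⟨his, hit⟩)

/-- A cost-minimal convex combination cannot be improved along an affine dependence that is
nonnegative off the support. -/
lemma sum_mul_nonneg_of_isMinOn {p : ι → E} {ω w : ι → ℝ} {x : E}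
    (hmin : IsMinOn (fun w : ι → ℝ => ∑ i, w i * ω i)
      {w | w ∈ stdSimplex ℝ ι ∧ ∑ i, w i • p i = x} w)
    (hw : w ∈ stdSimplex ℝ ι ∧ ∑ i, w i • p i = x) {β : ι → ℝ} (hβ0 : ∑ i, β i = 0)
    (hβp : ∑ i, β i • p i = 0) (hβ : ∀ i, w i = 0 → 0 ≤ β i) : 0 ≤ ∑ i, β i * ω i := by
  have hev : ∀ᶠ ε : ℝ in nhdsWithin 0 (Set.Ioi 0), ∀ i, 0 ≤ w i + ε * β i := by
    refine Filter.eventually_all.2 fun i => ?_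
    rcases (hw.1.1 i).eq_or_lt with h | h
    · filter_upwards [self_mem_nhdsWithin] with ε hε
      have := hβ i h.symm
      rw [← h, zero_add]
      exact mul_nonneg (le_of_lt hε) this
    · have hc : Filter.Tendsto (fun ε : ℝ => w i + ε * β i) (nhdsWithin 0 (Set.Ioi 0))
          (nhds (w i + 0 * β i)) :=
        ((by fun_prop : Continuous fun ε : ℝ => w i + ε * β i).tendsto 0).mono_left
          nhdsWithin_le_nhds
      rw [zero_mul, add_zero] at hc
      exact (hc.eventually_const_lt h).mono fun _ => le_of_lt
  obtain ⟨ε, hε, hε0⟩ := (hev.and self_mem_nhdsWithin).exists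
  have hε0 : 0 < ε := hε0
  have hle := hmin (a := fun i => w i + ε * β i) ⟨⟨hε, ?_⟩, ?_⟩
  · simp only [Set.mem_ofPred_eq, add_mul, Finset.sum_add_distrib, mul_assoc,
      ← Finset.mul_sum] at hle
    have : 0 ≤ ε * ∑ i, β i * ω i := by linarith
    exact nonneg_of_mul_nonneg_right this hε0
  · rw [Finset.sum_add_distrib, ← Finset.mul_sum, hβ0, hw.1.2]; simp
  · simp only [add_smul, mul_smul, Finset.sum_add_distrib, ← Finset.smul_sum, hβp, hw.2]; simp

variable [FiniteDimensional ℝ E]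

omit [Fintype ι] in
lemma card_le_finrank_add_one_of_affineIndependent {p : ι → E} {s : Finset ι}
    (hs : AffineIndependent ℝ (fun i : s => p i)) : s.card ≤ Module.finrank ℝ E + 1 := by
  have h1 := hs.card_le_finrank_succ
  have h2 := Submodule.finrank_le (vectorSpan ℝ (Set.range fun i : s => p i))
  rw [Fintype.card_coe] at h1
  omega

/-- Every point of the convex hull that is not spanned by too few of the points lies in a
full-dimensional lower cell. -/
lemma exists_isLowerCell_mem_convexHull {p : ι → E} {ω : ι → ℝ} (hω : IsGenericHeight p ω) {x : E}
    (hx : x ∈ convexHull ℝ (Set.range p))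
    (hxs : ∀ s : Finset ι, s.card ≤ Module.finrank ℝ E → x ∉ convexHull ℝ (p '' s)) :
    ∃ s : Finset ι, s.card = Module.finrank ℝ E + 1 ∧ IsLowerCell p ω s ∧
      x ∈ convexHull ℝ (p '' s) := by
  classical
  -- Linear programming: the cheapest way to write `x` as a convex combination has the lower cell
  -- containing `x` as its support.
  have hK : IsCompact {w | w ∈ stdSimplex ℝ ι ∧ ∑ i, w i • p i = x} :=
    (isCompact_stdSimplex ℝ ι).inter_right (isClosed_eq (by fun_prop) continuous_const)
  have hne : {w | w ∈ stdSimplex ℝ ι ∧ ∑ i, w i • p i = x}.Nonempty := by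
    have h := (mem_convexHull_image_iff_exists_weights p Finset.univ x).1 (by simpa using hx)
    obtain ⟨w, hw0, -, hw1, hwx⟩ := h
    exact ⟨w, ⟨hw0, hw1⟩, hwx⟩
  obtain ⟨w, hw, hmin⟩ := hK.exists_isMinOn hne
    (f := fun w : ι → ℝ => ∑ i, w i * ω i) (by fun_prop)
  set s : Finset ι := Finset.univ.filter fun i => w i ≠ 0 with hs
  have hws : ∀ i, w i = 0 ↔ i ∉ s := fun i => by simp [hs]
  have hpert : ∀ β : ι → ℝ, ∑ i, β i = 0 → ∑ i, β i • p i = 0 → (∀ i ∉ s, 0 ≤ β i) →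
      0 ≤ ∑ i, β i * ω i := fun β h0 hp hβ =>
    sum_mul_nonneg_of_isMinOn hmin hw h0 hp fun i hi => hβ i ((hws i).1 hi)
  -- A dependence on the support can be followed in both directions, so minimality forces its cost
  -- to vanish, against genericity.
  have hind : AffineIndependent ℝ (fun i : s => p i) := by
    by_contra hd
    obtain ⟨β, hβs, hβ0, hβp, hne⟩ := hω s hd
    have h1 := hpert β hβ0 hβp fun i hi => (hβs i hi).ge
    have h2 := hpert (-β) (by simp [hβ0]) (by simp [hβp]) fun i hi => by simp [hβs i hi]
    simp only [Pi.neg_apply, neg_mul, Finset.sum_neg_distrib] at h2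
    exact hne (by linarith)
  have hxm : x ∈ convexHull ℝ (p '' s) :=
    (mem_convexHull_image_iff_exists_weights p s x).2
      ⟨w, hw.1.1, fun i hi => (hws i).2 hi, hw.1.2, hw.2⟩
  have hcard : s.card = Module.finrank ℝ E + 1 := by
    have h1 := card_le_finrank_add_one_of_affineIndependent hind
    have h2 : ¬ s.card ≤ Module.finrank ℝ E := fun h => hxs s h hxm
    omega
  have htot : affineSpan ℝ (Set.range fun i : s => p i) = ⊤ := by
    rw [hind.affineSpan_eq_top_iff_card_eq_finrank_add_one, Fintype.card_coe, hcard]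
  let b : AffineBasis s ℝ E := ⟨fun i : s => p i, hind, htot⟩
  have hb : ∀ i : s, b i = p i := fun i => rfl
  -- The affine function interpolating the heights on the simplex. It lies below `ω` at `v` because
  -- moving weight from the barycentric coordinates of `p v` onto `v` itself cannot lower the cost.
  let h : E →ᵃ[ℝ] ℝ := ∑ i : s, ω i • b.coord i
  have hh : ∀ y, h y = ∑ i : s, ω i * b.coord i y := fun y => by
    have : ∀ t : Finset s, (∑ i ∈ t, ω i • b.coord i : E →ᵃ[ℝ] ℝ) y =
        ∑ i ∈ t, ω i * b.coord i y := fun t => by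
      induction t using Finset.induction_on with
      | empty => simp
      | insert a t ha ih => rw [Finset.sum_insert ha, Finset.sum_insert ha, ← ih]; simp
    exact this _
  have hhs : ∀ i ∈ s, h (p i) = ω i := fun i hi => by
    rw [hh, ← hb ⟨i, hi⟩]
    simp [AffineBasis.coord_apply]
  have hle : ∀ v, h (p v) ≤ ω v := by
    intro v
    set α : ι → ℝ := fun j => if hj : j ∈ s then b.coord ⟨j, hj⟩ (p v) else 0 with hα
    have hαs : ∀ j : s, α j = b.coord j (p v) := fun j => by simp [hα]
    have hαn : ∀ j ∉ s, α j = 0 := fun j hj => by simp [hα, hj]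
    have hα1 : ∑ j, α j = 1 := by
      rw [← Finset.sum_subset (Finset.subset_univ s) fun i _ hi => hαn i hi,
        ← Finset.sum_coe_sort]
      simpa only [hαs] using b.sum_coord_apply_eq_one (p v)
    have hαp : ∑ j, α j • p j = p v := by
      rw [← Finset.sum_subset (Finset.subset_univ s) fun i _ hi => by simp [hαn i hi],
        ← Finset.sum_coe_sort]
      simp only [hαs]
      exact b.linear_combination_coord_eq_self (p v)
    have hαω : ∑ j, α j * ω j = h (p v) := by
      rw [← Finset.sum_subset (Finset.subset_univ s) fun i _ hi => by simp [hαn i hi],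
        ← Finset.sum_coe_sort, hh]
      simp only [hαs, mul_comm]
    have := hpert (fun j => (Pi.single v 1 : ι → ℝ) j - α j) (by simp [hα1])
      (by
        simp only [sub_smul, Finset.sum_sub_distrib, hαp]
        rw [Finset.sum_eq_single v] <;> simp +contextual)
      (fun j hj => by
        rw [hαn j hj, sub_zero]
        by_cases hjv : j = v
        · subst hjv; simp
        · simp [hjv])
    simp only [sub_mul, Finset.sum_sub_distrib, hαω, Pi.single_apply, ite_mul, one_mul, zero_mul,
      Finset.sum_ite_eq', Finset.mem_univ, if_true] at this
    linarith
  have hcell : IsLowerCell p ω (Finset.univ.filter fun i => h (p i) = ω i) :=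
    ⟨h, fun i => ⟨hle i, by simp⟩⟩
  -- The contact set of `h` might exceed `s`, but it is affinely independent and `s` already has the
  -- maximal size.
  have hsub : s ⊆ Finset.univ.filter fun i => h (p i) = ω i := fun i hi => by simp [hhs i hi]
  have heq := Finset.eq_of_subset_of_card_le hsub
    (by rw [hcard]
        exact card_le_finrank_add_one_of_affineIndependent (hcell.affineIndependent hω))
  exact ⟨s, hcard, heq ▸ hcell, hxm⟩

omit [Fintype ι] in
open MeasureTheory in
lemma measure_convexHull_image_eq_zero [MeasurableSpace E] [BorelSpace E] (μ : Measure E)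
    [μ.IsAddHaarMeasure] (p : ι → E) (s : Finset ι) (hs : s.card ≤ Module.finrank ℝ E) :
    μ (convexHull ℝ (p '' s)) = 0 := by
  classical
  rcases s.eq_empty_or_nonempty with rfl | hne
  · simp
  refine measure_mono_null (convexHull_subset_affineSpan _)
    (Measure.addHaar_affineSubspace μ _ fun htop => ?_)
  have hpos := hne.card_pos
  have h1 := finrank_vectorSpan_image_finset_le ℝ p s (n := s.card - 1) (by omega)
  have h2 : vectorSpan ℝ (p '' s) = ⊤ := by
    rw [← direction_affineSpan, htop, AffineSubspace.direction_top]
  rw [Finset.coe_image, h2, finrank_top] at h1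
  omega

open MeasureTheory in
/-- Up to a null set, the convex hull of finitely many points is the disjoint union of
full-dimensional simplices spanned by these points. -/
theorem exists_ae_triangulation [MeasurableSpace E] [BorelSpace E] (μ : Measure E)
    [μ.IsAddHaarMeasure] (p : ι → E) :
    ∃ (𝒯 : Finset (Finset ι)) (N : Set E), μ N = 0 ∧
      (∀ s ∈ 𝒯, s.card = Module.finrank ℝ E + 1 ∧ AffineIndependent ℝ (fun i : s => p i)) ∧
      ∀ y ∉ N, (y ∈ convexHull ℝ (Set.range p) ↔ ∃ s ∈ 𝒯, y ∈ convexHull ℝ (p '' s)) ∧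
        ∀ s ∈ 𝒯, ∀ t ∈ 𝒯, y ∈ convexHull ℝ (p '' s) → y ∈ convexHull ℝ (p '' t) → s = t := by
  classical
  obtain ⟨ω, hω⟩ := exists_isGenericHeight p
  refine ⟨Finset.univ.filter fun s => s.card = Module.finrank ℝ E + 1 ∧ IsLowerCell p ω s,
    ⋃ s ∈ {s : Finset ι | s.card ≤ Module.finrank ℝ E}, convexHull ℝ (p '' s), ?_, ?_, ?_⟩
  · exact (measure_biUnion_null_iff (Set.to_countable _)).2
      fun s hs => measure_convexHull_image_eq_zero μ p s hs
  · intro s hs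
    have hs := (Finset.mem_filter.1 hs).2
    exact ⟨hs.1, hs.2.affineIndependent hω⟩
  · intro y hy
    have hy' : ∀ s : Finset ι, s.card ≤ Module.finrank ℝ E → y ∉ convexHull ℝ (p '' s) :=
      fun s hs hys => hy (Set.mem_biUnion (Set.mem_ofPred.2 hs) hys)
    refine ⟨⟨fun h => ?_, fun ⟨s, _, h⟩ => convexHull_mono (Set.image_subset_range _ _) h⟩, ?_⟩
    · obtain ⟨s, h1, h2, h3⟩ := exists_isLowerCell_mem_convexHull hω h hy'
      exact ⟨s, by simp [h1, h2], h3⟩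
    · intro s hs t ht hys hyt
      have hs := (Finset.mem_filter.1 hs).2
      have ht := (Finset.mem_filter.1 ht).2
      have hi := hs.2.mem_convexHull_inter ht.2 hys hyt
      -- Off the null set, `y` needs more than `finrank` points, so the common face is already all
      -- of both cells.
      have hc : Module.finrank ℝ E < (s ∩ t).card := by
        by_contra hc
        exact hy' _ (not_lt.1 hc) hi
      have h1 := Finset.eq_of_subset_of_card_le (Finset.inter_subset_left (s₁ := s) (s₂ := t))
        (by omega)
      have h2 := Finset.eq_of_subset_of_card_le (Finset.inter_subset_right (s₁ := s) (s₂ := t))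
        (by omega)
      exact h1.symm.trans h2

end Triangulation

/-! ### Counting integer points modulo a sublattice. -/

section LatticeCount

variable {d : ℕ}

/-- The lattice `ℤ^d` as an additive subgroup of `ℝ^d`. -/
def integerSubgroup (d : ℕ) : AddSubgroup (Fin d → ℝ) where
  carrier := integerPoints d
  zero_mem' := fun _ => ⟨0, by simp⟩
  add_mem' := fun {a b} ha hb i => by
    obtain ⟨m, hm⟩ := ha i
    obtain ⟨k, hk⟩ := hb i
    exact ⟨m + k, by simp [hm, hk]⟩
  neg_mem' := fun {a} ha i => by
    obtain ⟨m, hm⟩ := ha i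
    exact ⟨-m, by simp [hm]⟩

lemma span_le_integerSubgroup {ι : Type*} {b : ι → Fin d → ℝ} (hb : ∀ i, b i ∈ integerPoints d)
    {y : Fin d → ℝ} (hy : y ∈ Submodule.span ℤ (Set.range b)) : y ∈ integerSubgroup d := by
  have : Submodule.span ℤ (Set.range b) ≤ AddSubgroup.toIntSubmodule (integerSubgroup d) :=
    Submodule.span_le.2 (by rintro _ ⟨i, rfl⟩; exact hb i)
  exact this hy

lemma integerPoints_eq_range :
    integerPoints d = Set.range fun (m : Fin d → ℤ) (i : Fin d) => (m i : ℝ) := by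
  ext x
  constructor
  · intro hx
    choose m hm using hx
    exact ⟨m, funext fun i => (hm i).symm⟩
  · rintro ⟨m, rfl⟩ i
    exact ⟨m i, rfl⟩

lemma countable_integerPoints : (integerPoints d).Countable := by
  rw [integerPoints_eq_range]
  exact Set.countable_range _

lemma finite_integerPoints_inter {B : Set (Fin d → ℝ)} (hB : Bornology.IsBounded B) :
    (integerPoints d ∩ B).Finite := by
  obtain ⟨r, hr⟩ := hB.subset_closedBall 0
  refine ((Set.finite_Icc (fun _ : Fin d => -⌈r⌉) (fun _ => ⌈r⌉)).image
    fun (m : Fin d → ℤ) (i : Fin d) => (m i : ℝ)).subset ?_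
  rintro x ⟨hx, hxB⟩
  rw [integerPoints_eq_range] at hx
  obtain ⟨m, rfl⟩ := hx
  refine ⟨m, ?_, rfl⟩
  have h1 := hr hxB
  rw [mem_closedBall_zero_iff] at h1
  have h2 : ∀ i, |(m i : ℝ)| ≤ ⌈r⌉ := fun i =>
    ((norm_le_pi_norm (fun i => (m i : ℝ)) i).trans h1).trans (Int.le_ceil r)
  have h3 : ∀ i, |m i| ≤ ⌈r⌉ := fun i => by exact_mod_cast h2 i
  exact ⟨fun i => (abs_le.1 (h3 i)).1, fun i => (abs_le.1 (h3 i)).2⟩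

/-- The integer points whose translate by `-x` lies in `C`. -/
def shiftedPoints (C : Set (Fin d → ℝ)) (x : Fin d → ℝ) : Set (Fin d → ℝ) :=
  {u | u ∈ integerPoints d ∧ u - x ∈ C}

lemma latticeCount_eq_ncard (C : Set (Fin d → ℝ)) (x : Fin d → ℝ) :
    latticeCount C x = (shiftedPoints C x).ncard := by
  unfold latticeCount shiftedPoints
  congr 1
  ext u
  simp only [Set.add_singleton, Set.mem_inter_iff, Set.mem_image, Set.mem_ofPred_eq]
  constructor
  · rintro ⟨⟨y, hy, rfl⟩, hu⟩
    exact ⟨hu, by simpa using hy⟩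
  · rintro ⟨hu, hy⟩
    exact ⟨⟨u - x, hy, by simp⟩, hu⟩

lemma finite_shiftedPoints {C : Set (Fin d → ℝ)} (hC : Bornology.IsBounded C) (x : Fin d → ℝ) :
    (shiftedPoints C x).Finite := by
  refine (finite_integerPoints_inter (hC.vadd x)).subset fun u hu => ⟨hu.1, ?_⟩
  exact ⟨u - x, hu.2, by simp⟩

/-- The lattice count is invariant under translations of the set by integer vectors. -/
lemma latticeCount_vadd {v : Fin d → ℝ} (hv : v ∈ integerPoints d) (C : Set (Fin d → ℝ))
    (x : Fin d → ℝ) : latticeCount (v +ᵥ C) x = latticeCount C x := by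
  rw [latticeCount_eq_ncard, latticeCount_eq_ncard,
    ← Set.ncard_image_of_injective (shiftedPoints C x) (add_right_injective v)]
  congr 1
  ext u
  simp only [shiftedPoints, Set.mem_ofPred_eq, Set.mem_image, Set.mem_vadd_set]
  constructor
  · rintro ⟨hu, y, hy, hyu⟩
    refine ⟨u - v, ⟨(integerSubgroup d).sub_mem hu hv, ?_⟩, by simp⟩
    rw [vadd_eq_add] at hyu
    have : u - v - x = y := by rw [sub_right_comm, ← hyu]; simp
    rwa [this]
  · rintro ⟨y, ⟨hy, hyC⟩, rfl⟩
    exact ⟨(integerSubgroup d).add_mem hv hy, y - x, hyC, by rw [vadd_eq_add]; abel⟩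

/-- The number of integer points in a translate of the half-open parallelepiped spanned by integer
vectors does not depend on the translation. -/
lemma exists_latticeCount_fundamentalDomain_eq (b : Module.Basis (Fin d) ℝ (Fin d → ℝ))
    (hb : ∀ i, b i ∈ integerPoints d) :
    ∃ K : ℕ, ∀ x, latticeCount (ZSpan.fundamentalDomain b) x = K := by
  refine ⟨(ZSpan.fract b '' integerPoints d).ncard, fun x => ?_⟩
  -- Each class modulo the sublattice has exactly one representative in the translated domain, so
  -- the count is the number of classes.
  have himg : ZSpan.fract b '' integerPoints d =
      ZSpan.fract b '' shiftedPoints (ZSpan.fundamentalDomain b) x := by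
    refine Set.Subset.antisymm ?_ (Set.image_mono fun u hu => hu.1)
    rintro _ ⟨z, hz, rfl⟩
    have hfl := span_le_integerSubgroup hb (ZSpan.floor b (z - x)).2
    refine ⟨z - ZSpan.floor b (z - x), ⟨(integerSubgroup d).sub_mem hz hfl, ?_⟩, ?_⟩
    · rw [sub_right_comm, ← ZSpan.fract_apply]
      exact ZSpan.fract_mem_fundamentalDomain b _
    · rw [ZSpan.fract_eq_fract]
      simp
  rw [latticeCount_eq_ncard, himg, Set.InjOn.ncard_image]
  intro u hu u' hu' h
  rw [ZSpan.fract_eq_fract] at h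
  have h2 : ZSpan.fract b (u - x) = ZSpan.fract b (u' - x) := by
    rw [ZSpan.fract_eq_fract]
    convert h using 1
    abel
  rw [ZSpan.fract_eq_self.2 hu.2, ZSpan.fract_eq_self.2 hu'.2] at h2
  simpa using h2

/-- Lattice counting, sorted by the classes modulo the sublattice spanned by an integer basis. -/
lemma latticeCount_eq_sum_fundamentalDomain (b : Module.Basis (Fin d) ℝ (Fin d → ℝ))
    (hb : ∀ i, b i ∈ integerPoints d) {C : Set (Fin d → ℝ)} (hC : Bornology.IsBounded C)
    (x : Fin d → ℝ) :
    latticeCount C x =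
      ∑ a ∈ (finite_shiftedPoints (ZSpan.fundamentalDomain_isBounded b) x).toFinset,
        {m : Fin d → ℤ | a - x + ∑ i, m i • b i ∈ C}.ncard := by
  classical
  have hCf := finite_shiftedPoints hC x
  have hfl : ∀ y, (ZSpan.floor b y : Fin d → ℝ) ∈ integerSubgroup d := fun y =>
    span_le_integerSubgroup hb (ZSpan.floor b y).2
  -- The fibre map sends `u` to the point of its class lying in the fundamental domain translated by
  -- `x`.
  rw [latticeCount_eq_ncard, Set.ncard_eq_toFinset_card _ hCf,
    Finset.card_eq_sum_card_fiberwise (f := fun u => u - (ZSpan.floor b (u - x) : Fin d → ℝ))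
      (t := (finite_shiftedPoints (ZSpan.fundamentalDomain_isBounded b) x).toFinset)]
  · refine Finset.sum_congr rfl fun a ha => ?_
    have ha : a ∈ shiftedPoints (ZSpan.fundamentalDomain b) x := by simpa using ha
    have hinj : Function.Injective fun m : Fin d → ℤ => a + ∑ i, m i • b i := by
      intro m m' h
      have h1 : ∑ i, (m i : ℝ) • b i = ∑ i, (m' i : ℝ) • b i := by
        simpa [Int.cast_smul_eq_zsmul] using h
      ext i
      have h2 := congrArg (fun y => b.repr y i) h1
      rw [b.repr_sum_self, b.repr_sum_self] at h2
      exact_mod_cast h2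
    rw [← Set.ncard_image_of_injective _ hinj, ← Set.ncard_coe_finset]
    congr 1
    ext u
    simp only [Finset.coe_filter, Set.Finite.mem_toFinset, Set.mem_ofPred_eq, Set.mem_image]
    constructor
    · rintro ⟨⟨hu, huC⟩, rfl⟩
      have h1 : ((ZSpan.floor b (u - x) : Submodule.span ℤ (Set.range b)) : Fin d → ℝ) =
          ∑ i, ⌊b.repr (u - x) i⌋ • b i := by
        simp [ZSpan.floor]
      refine ⟨fun i => ⌊b.repr (u - x) i⌋, ?_, ?_⟩
      · rw [← h1, sub_right_comm, sub_add_cancel]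
        exact huC
      · rw [← h1, sub_add_cancel]
    · rintro ⟨m, hm, rfl⟩
      have hs : ∑ i, m i • b i ∈ Submodule.span ℤ (Set.range b) :=
        Submodule.sum_mem _ fun i _ =>
          Submodule.smul_mem _ _ (Submodule.subset_span (Set.mem_range_self i))
      refine ⟨⟨(integerSubgroup d).add_mem ha.1 (span_le_integerSubgroup hb hs), ?_⟩, ?_⟩
      · rwa [add_sub_right_comm]
      · have h1 : ZSpan.fract b (a + ∑ i, m i • b i - x) = a - x := by
          rw [add_sub_right_comm, ZSpan.fract_add_ZSpan b _ hs, ZSpan.fract_eq_self.2 ha.2]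
        rw [ZSpan.fract_apply] at h1
        have h2 := congrArg (· + x) h1
        simp only [sub_add_cancel] at h2
        refine Eq.trans ?_ h2
        abel
  · intro u hu
    have hu : u ∈ shiftedPoints C x := by simpa using hu
    simp only [Set.Finite.coe_toFinset]
    refine ⟨(integerSubgroup d).sub_mem hu.1 (hfl _), ?_⟩
    rw [sub_right_comm, ← ZSpan.fract_apply]
    exact ZSpan.fract_mem_fundamentalDomain b _

end LatticeCount

/-! ### Lattice points of dilated standard simplices. -/

section Counting

/-- Stars and bars: a slack coordinate `k - ∑ m i` turns the inequality into an equation in `d + 1`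
variables. -/
lemma ncard_sum_le (d k : ℕ) :
    {m : Fin d → ℕ | ∑ i, m i ≤ k}.ncard = (k + d).choose d := by
  classical
  have h : {m : Fin d → ℕ | ∑ i, m i ≤ k} =
      Fin.tail '' ((Finset.univ : Finset (Fin (d + 1))).piAntidiag k : Set (Fin (d + 1) → ℕ)) := by
    ext m
    simp only [Set.mem_ofPred_eq, Set.mem_image, Finset.mem_coe, Finset.mem_piAntidiag]
    constructor
    · intro hm
      refine ⟨Fin.cons (k - ∑ i, m i) m, ⟨?_, by simp⟩, by simp⟩
      rw [Fin.sum_univ_succ]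
      simp only [Fin.cons_zero, Fin.cons_succ]
      omega
    · rintro ⟨f, ⟨hf, -⟩, rfl⟩
      rw [Fin.sum_univ_succ] at hf
      simp only [Fin.tail]
      omega
  rw [h, Set.InjOn.ncard_image, Set.ncard_coe_finset, ← Finset.map_sym_eq_piAntidiag,
    Finset.card_map, Finset.sym_univ, Finset.card_univ, Sym.card_sym_eq_choose, Fintype.card_fin]
  · rw [show d + 1 + k - 1 = k + d by omega, ← Nat.choose_symm_add]
  · intro f hf g hg hfg
    simp only [Finset.mem_coe, Finset.mem_piAntidiag, Fin.sum_univ_succ] at hf hg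
    have ht : ∀ i : Fin d, f i.succ = g i.succ := fun i => congrFun hfg i
    ext i
    refine Fin.cases ?_ ht i
    have h1 := hf.1
    have h2 := hg.1
    simp only [ht] at h1
    omega

/-- The count behind the Ehrhart polynomial of a simplex in dimension three. -/
lemma ncard_sum_add_le {n : ℕ} (hn : 0 < n) {s : ℝ} (h0 : 0 < s) (h3 : s < 3) (h2 : s ≠ 2) :
    ({m : Fin 3 → ℕ | ((∑ i, m i : ℕ) : ℝ) + s ≤ n}.ncard : ℝ) =
      n * (n + 1) / 2 * (if s ≤ 1 then 1 else 0) - n * (n - 1) / 2 * (if 2 < s then 1 else 0)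
        + ((n : ℝ) ^ 3 - n) / 6 := by
  -- Here `j = ⌈s⌉`; as the sum of the `m i` is an integer, `s` may be rounded up to `j`.
  have key : ∀ j : ℕ, 0 < j → j ≤ 3 → (j : ℝ) - 1 < s → s ≤ j →
      {m : Fin 3 → ℕ | ((∑ i, m i : ℕ) : ℝ) + s ≤ n}.ncard = (n + 3 - j).choose 3 := by
    intro j hj0 hj hjs hsj
    have hset : {m : Fin 3 → ℕ | ((∑ i, m i : ℕ) : ℝ) + s ≤ n} =
        {m : Fin 3 → ℕ | ∑ i, m i + j ≤ n} := by
      ext m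
      simp only [Set.mem_ofPred_eq]
      constructor
      · intro h
        have : ((∑ i, m i + j : ℕ) : ℝ) < (n + 1 : ℕ) := by push_cast at h ⊢; linarith
        exact Nat.lt_succ_iff.1 (by exact_mod_cast this)
      · intro h
        have : ((∑ i, m i + j : ℕ) : ℝ) ≤ n := by exact_mod_cast h
        push_cast at this ⊢
        linarith
    rw [hset]
    rcases le_or_gt j n with hjn | hjn
    · rw [show n + 3 - j = n - j + 3 by omega, ← ncard_sum_le]
      congr 1
      ext m
      simp only [Set.mem_ofPred_eq]
      omega
    · rw [Nat.choose_eq_zero_of_lt (by omega)]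
      convert Set.ncard_empty (Fin 3 → ℕ)
      ext m
      simp only [Set.mem_ofPred_eq, Set.mem_empty_iff_false, iff_false]
      omega
  obtain ⟨n, rfl⟩ : ∃ k, n = k + 1 := ⟨n - 1, by omega⟩
  have hchoose : ∀ k : ℕ, (k.choose 3 : ℝ) = k * (k - 1) * (k - 2) / 6 := by
    intro k
    induction k with
    | zero => simp
    | succ k ih =>
      rw [Nat.choose_succ_succ' k 2, Nat.cast_add, ih, Nat.cast_choose_two]
      push_cast
      ring
  rcases le_or_gt s 1 with hs1 | hs1
  · rw [key 1 (by norm_num) (by norm_num) (by simpa using h0) (by simpa using hs1), hchoose,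
      if_pos hs1, if_neg (by linarith), show n + 1 + 3 - 1 = n + 3 by omega]
    push_cast
    ring
  · rcases lt_or_gt_of_ne h2 with hs2 | hs2
    · rw [key 2 (by norm_num) (by norm_num) (by norm_num; linarith) (by norm_num; linarith),
        hchoose, if_neg (by linarith), if_neg (by linarith), show n + 1 + 3 - 2 = n + 2 by omega]
      push_cast
      ring
    · rw [key 3 (by norm_num) (by norm_num) (by norm_num; linarith) (by norm_num; linarith),
        hchoose, if_neg (by linarith), if_pos hs2, show n + 1 + 3 - 3 = n + 1 by omega]
      push_cast
      ring

end Counting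

/-! ### The relation for one lattice simplex. -/

section Simplex

open MeasureTheory

variable {d : ℕ}

/-- The points with nonnegative coordinates of sum at most `c` in the basis `b`. -/
def cornerSimplex (b : Module.Basis (Fin d) ℝ (Fin d → ℝ)) (c : ℝ) : Set (Fin d → ℝ) :=
  {y | (∀ i, 0 ≤ b.repr y i) ∧ ∑ i, b.repr y i ≤ c}

lemma repr_add_sum_zsmul (b : Module.Basis (Fin d) ℝ (Fin d → ℝ)) (y : Fin d → ℝ) (m : Fin d → ℤ)
    (i : Fin d) : b.repr (y + ∑ j, m j • b j) i = b.repr y i + m i := by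
  have : ∑ j, m j • b j = ∑ j, (m j : ℝ) • b j := by simp [Int.cast_smul_eq_zsmul]
  rw [this, map_add, Finsupp.add_apply, b.repr_sum_self]

/-- Since the coordinates of `y` lie in `[0,1)`, adding an integer keeps them nonnegative only if
that integer is nonnegative. -/
lemma ncard_add_mem_cornerSimplex (b : Module.Basis (Fin d) ℝ (Fin d → ℝ)) {y : Fin d → ℝ}
    (hy : y ∈ ZSpan.fundamentalDomain b) (c : ℝ) :
    {m : Fin d → ℤ | y + ∑ i, m i • b i ∈ cornerSimplex b c}.ncard =
      {m : Fin d → ℕ | ((∑ i, m i : ℕ) : ℝ) + ∑ i, b.repr y i ≤ c}.ncard := by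
  have hinj : Function.Injective fun (m : Fin d → ℕ) (i : Fin d) => (m i : ℤ) := by
    intro m m' h
    ext i
    simpa using congrFun h i
  rw [← Set.ncard_image_of_injective _ hinj]
  congr 1
  ext m
  simp only [cornerSimplex, repr_add_sum_zsmul, Set.mem_ofPred_eq, Set.mem_image]
  constructor
  · rintro ⟨h0, hc⟩
    have hm : ∀ i, 0 ≤ m i := fun i => by
      have h1 := h0 i
      have h2 := (hy i).2
      have : (-1 : ℝ) < m i := by linarith
      have : (-1 : ℤ) < m i := by exact_mod_cast this
      omega
    lift m to Fin d → ℕ using hm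
    refine ⟨m, ?_, rfl⟩
    rw [Finset.sum_add_distrib] at hc
    push_cast at hc ⊢
    linarith
  · rintro ⟨k, hk, rfl⟩
    refine ⟨fun i => add_nonneg (hy i).1 (by simp), ?_⟩
    rw [Finset.sum_add_distrib]
    push_cast at hk ⊢
    linarith

lemma ncard_add_mem_neg_cornerSimplex (b : Module.Basis (Fin d) ℝ (Fin d → ℝ)) {y : Fin d → ℝ}
    (hy : y ∈ ZSpan.fundamentalDomain b) (hy0 : ∀ i, b.repr y i ≠ 0) (c : ℝ) :
    {m : Fin d → ℤ | y + ∑ i, m i • b i ∈ -cornerSimplex b c}.ncard =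
      {m : Fin d → ℕ | ((∑ i, m i : ℕ) : ℝ) + (d - ∑ i, b.repr y i) ≤ c}.ncard := by
  have hinj : Function.Injective fun (m : Fin d → ℕ) (i : Fin d) => (-1 - m i : ℤ) := by
    intro m m' h
    ext i
    have := congrFun h i
    simp only at this
    omega
  rw [← Set.ncard_image_of_injective _ hinj]
  congr 1
  ext m
  simp only [cornerSimplex, Set.mem_neg, map_neg, Finsupp.neg_apply, repr_add_sum_zsmul,
    Set.mem_ofPred_eq, Set.mem_image, Finset.sum_neg_distrib, Finset.sum_add_distrib]
  constructor
  · rintro ⟨h0, hc⟩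
    have hm : ∀ i, 0 ≤ -1 - m i := fun i => by
      have h1 := h0 i
      have h2 := (hy i).1.lt_of_ne (hy0 i).symm
      have : (m i : ℝ) < 0 := by linarith
      have : m i < 0 := by exact_mod_cast this
      omega
    refine ⟨fun i => (-1 - m i).toNat, ?_, funext fun i => ?_⟩
    · have h1 : ∀ i, (((-1 - m i).toNat : ℕ) : ℝ) = -1 - m i := fun i => by
        have : (((-1 - m i).toNat : ℕ) : ℤ) = -1 - m i := Int.toNat_of_nonneg (hm i)
        exact_mod_cast this
      push_cast
      simp only [h1, Finset.sum_sub_distrib, Finset.sum_const, Finset.card_univ, Fintype.card_fin,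
        nsmul_eq_mul]
      linarith
    · have := hm i
      change -1 - (((-1 - m i).toNat : ℕ) : ℤ) = m i
      omega
  · rintro ⟨k, hk, rfl⟩
    refine ⟨fun i => ?_, ?_⟩
    · have := (hy i).2
      have : (0 : ℝ) ≤ k i := by positivity
      push_cast
      linarith
    · push_cast at hk ⊢
      simp only [Finset.sum_sub_distrib, Finset.sum_const, Finset.card_univ, Fintype.card_fin,
        nsmul_eq_mul]
      linarith

lemma smul_cornerSimplex (b : Module.Basis (Fin d) ℝ (Fin d → ℝ)) {r : ℝ} (hr : 0 < r) (c : ℝ) :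
    r • cornerSimplex b c = cornerSimplex b (r * c) := by
  ext y
  rw [Set.mem_smul_set_iff_inv_smul_mem₀ hr.ne']
  simp only [cornerSimplex, Set.mem_ofPred_eq, map_smul, Finsupp.smul_apply, smul_eq_mul,
    ← Finset.mul_sum, inv_mul_le_iff₀ hr, inv_pos.2 hr, mul_nonneg_iff_of_pos_left]

lemma volume_linearMap_eq_const {ℓ : (Fin d → ℝ) →ₗ[ℝ] ℝ} (hℓ : ℓ ≠ 0) (c : ℝ) :
    volume {y | ℓ y = c} = 0 := by
  have h : {y | ℓ y = c} =
      ((AffineSubspace.mk' c (⊥ : Submodule ℝ ℝ)).comap ℓ.toAffineMap : Set (Fin d → ℝ)) := by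
    ext y
    simp [AffineSubspace.mem_mk', sub_eq_zero]
  rw [h]
  refine Measure.addHaar_affineSubspace volume _ fun htop => hℓ (LinearMap.ext fun y => ?_)
  have hall : ∀ y, ℓ y = c := fun y => by
    have : y ∈ {y | ℓ y = c} := by rw [h, htop]; trivial
    exact this
  rw [hall y, ← hall 0]
  simp

/-- There are countably many `u`, and `x ↦ u - x` preserves volume. -/
lemma ae_forall_integerPoints_sub_notMem {N : Set (Fin d → ℝ)} (hN : volume N = 0) :
    ∀ᵐ x, ∀ u ∈ integerPoints d, u - x ∉ N := by
  refine (ae_ball_iff countable_integerPoints).2 fun u _ => ?_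
  exact (Measure.measurePreserving_sub_left volume u).quasiMeasurePreserving.ae
    (measure_eq_zero_iff_ae_notMem.1 hN)

lemma cornerSimplex_relation (b : Module.Basis (Fin 3) ℝ (Fin 3 → ℝ))
    (hb : ∀ i, b i ∈ integerPoints 3) (hbd : Bornology.IsBounded (cornerSimplex b 1)) {n : ℕ}
    (hn : 0 < n) :
    ∃ K : ℝ, ∀ᵐ x, (latticeCount (cornerSimplex b n) x : ℝ) =
      n * (n + 1) / 2 * latticeCount (cornerSimplex b 1) x
        - n * (n - 1) / 2 * latticeCount (-cornerSimplex b 1) x + K := by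
  obtain ⟨K, hK⟩ := exists_latticeCount_fundamentalDomain_eq b hb
  refine ⟨K * (((n : ℝ) ^ 3 - n) / 6), ?_⟩
  have hbn : Bornology.IsBounded (cornerSimplex b n) := by
    have := hbd.smul₀ (n : ℝ)
    rwa [smul_cornerSimplex b (by exact_mod_cast hn), mul_one] at this
  -- Exclude translations placing an integer point where the reflected count deviates: a zero
  -- coordinate, or coordinate sum exactly 2.
  have h0 : volume (⋃ i, {y | b.coord i y = 0}) = 0 :=
    measure_iUnion_null fun i => volume_linearMap_eq_const (fun h => by
      have := LinearMap.congr_fun h (b i)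
      simp at this) 0
  have h2 : volume {y | (∑ i, b.coord i) y = 2} = 0 :=
    volume_linearMap_eq_const (fun h => by
      have := LinearMap.congr_fun h (b 0)
      simp [Finsupp.single_apply] at this) 2
  filter_upwards [ae_forall_integerPoints_sub_notMem h0, ae_forall_integerPoints_sub_notMem h2]
    with x hx0 hx2
  have hcard := hK x
  rw [latticeCount_eq_ncard, Set.ncard_eq_toFinset_card _
    (finite_shiftedPoints (ZSpan.fundamentalDomain_isBounded b) x)] at hcard
  rw [latticeCount_eq_sum_fundamentalDomain b hb hbn, latticeCount_eq_sum_fundamentalDomain b hb hbd,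
    latticeCount_eq_sum_fundamentalDomain b hb hbd.neg, ← hcard,
    ← nsmul_eq_mul _ (((n : ℝ) ^ 3 - n) / 6), ← Finset.sum_const]
  push_cast
  rw [Finset.mul_sum, Finset.mul_sum, ← Finset.sum_sub_distrib, ← Finset.sum_add_distrib]
  refine Finset.sum_congr rfl fun a ha => ?_
  have ha : a ∈ shiftedPoints (ZSpan.fundamentalDomain b) x := by simpa using ha
  have hne : ∀ i, b.repr (a - x) i ≠ 0 := fun i hi =>
    hx0 a ha.1 (Set.mem_iUnion.2 ⟨i, hi⟩)
  have hs2 : ∑ i, b.repr (a - x) i ≠ 2 := fun h => hx2 a ha.1 (by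
    simpa [LinearMap.sum_apply] using h)
  have hpos : ∀ i, 0 < b.repr (a - x) i := fun i => (ha.2 i).1.lt_of_ne (hne i).symm
  have hlt : ∀ i, b.repr (a - x) i < 1 := fun i => (ha.2 i).2
  rw [ncard_add_mem_cornerSimplex b ha.2, ncard_add_mem_cornerSimplex b ha.2,
    ncard_add_mem_neg_cornerSimplex b ha.2 hne]
  set s := ∑ i, b.repr (a - x) i with hs
  have hs0 : 0 < s := Finset.sum_pos (fun i _ => hpos i) Finset.univ_nonempty
  have hs3 : s < 3 := by
    rw [hs, Fin.sum_univ_three]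
    linarith [hlt 0, hlt 1, hlt 2]
  have e1 := ncard_sum_add_le hn hs0 hs3 hs2
  have e2 := ncard_sum_add_le one_pos hs0 hs3 hs2
  have e3 : ({m : Fin 3 → ℕ | ((∑ i, m i : ℕ) : ℝ) + ((3 : ℕ) - s) ≤ 1}.ncard : ℝ) =
      if 2 < s then 1 else 0 := by
    -- For `s = 1` the reflected sum `3 - s` is the value 2 excluded from the counting lemma; the
    -- set is then visibly empty.
    by_cases hs1 : s = 1
    · rw [if_neg (by rw [hs1]; norm_num), Nat.cast_eq_zero]
      convert Set.ncard_empty (Fin 3 → ℕ)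
      ext m
      simp only [Set.mem_ofPred_eq, Set.mem_empty_iff_false, iff_false, hs1, not_le]
      have : (0 : ℝ) ≤ ((∑ i, m i : ℕ) : ℝ) := Nat.cast_nonneg _
      push_cast at this ⊢
      linarith
    · have e := ncard_sum_add_le one_pos (s := (3 : ℕ) - s) (by push_cast; linarith)
        (by push_cast; linarith) (fun h => hs1 (by push_cast at h; linarith))
      rw [Nat.cast_one] at e
      rw [e]
      have : ((3 : ℕ) - s ≤ 1) ↔ 2 < s := by
        push_cast
        constructor
        · intro h
          exact lt_of_le_of_ne (by linarith) hs2.symm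
        · intro h
          linarith
      simp only [this]
      norm_num
  rw [Nat.cast_one] at e2
  rw [e1, e2, e3]
  ring

lemma bounded_convexHull_range {ι : Type*} [Finite ι] (v : ι → Fin d → ℝ) :
    Bornology.IsBounded (convexHull ℝ (Set.range v)) :=
  isBounded_convexHull.2 (Set.finite_range v).isBounded

lemma convexHull_range_eq_vadd_cornerSimplex (v : Fin (d + 1) → Fin d → ℝ)
    (b : Module.Basis (Fin d) ℝ (Fin d → ℝ)) (hb : ∀ i, b i = v i.succ - v 0) :
    convexHull ℝ (Set.range v) = v 0 +ᵥ cornerSimplex b 1 := by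
  refine Set.Subset.antisymm (convexHull_min ?_ ?_) ?_
  · rintro _ ⟨i, rfl⟩
    refine ⟨v i - v 0, ?_, by simp⟩
    refine Fin.cases ?_ (fun i => ?_) i
    · simp [cornerSimplex]
    · rw [← hb]
      refine ⟨fun j => ?_, ?_⟩
      · rw [b.repr_self]
        exact Finsupp.single_nonneg.2 zero_le_one j
      · simp [Finsupp.single_apply]
  · refine Convex.vadd ?_ _
    rintro y ⟨hy0, hy1⟩ z ⟨hz0, hz1⟩ p q hp hq hpq
    refine ⟨fun i => ?_, ?_⟩
    · have := hy0 i
      have := hz0 i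
      simp only [map_add, map_smul, Finsupp.add_apply, Finsupp.smul_apply, smul_eq_mul]
      positivity
    · simp only [map_add, map_smul, Finsupp.add_apply, Finsupp.smul_apply, smul_eq_mul,
        Finset.sum_add_distrib, ← Finset.mul_sum]
      calc _ ≤ p * 1 + q * 1 := by gcongr
        _ = 1 := by linarith
  · rintro _ ⟨y, ⟨hy0, hy1⟩, rfl⟩
    refine mem_convexHull_of_exists_fintype
      (Fin.cons (1 - ∑ i, b.repr y i) (fun i => b.repr y i) : Fin (d + 1) → ℝ) v
      (fun i => Fin.cases (by simpa using hy1) (fun i => by simpa using hy0 i) i) ?_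
      (fun i => Set.mem_range_self i) ?_
    · simp [Fin.sum_univ_succ]
    · simp only [Fin.sum_univ_succ, Fin.cons_zero, Fin.cons_succ, sub_smul, one_smul, vadd_eq_add]
      conv_rhs => rw [← b.sum_repr y]
      simp only [hb, smul_sub, Finset.sum_sub_distrib, ← Finset.sum_smul]
      abel

/-- The lattice count relation between the dilates of an integer simplex and its reflection. -/
theorem latticeCount_simplex_relation {v : Fin 4 → Fin 3 → ℝ} (hv : ∀ i, v i ∈ integerPoints 3)
    (hind : AffineIndependent ℝ v) {n : ℕ} (hn : 0 < n) :
    ∃ K : ℝ, ∀ᵐ x, (latticeCount ((n : ℝ) • convexHull ℝ (Set.range v)) x : ℝ) =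
      n * (n + 1) / 2 * latticeCount (convexHull ℝ (Set.range v)) x
        - n * (n - 1) / 2 * latticeCount (-convexHull ℝ (Set.range v)) x + K := by
  have hlin : LinearIndependent ℝ fun i : Fin 3 => v i.succ - v 0 := by
    have h := (affineIndependent_iff_linearIndependent_vsub ℝ v 0).1 hind
    exact h.comp (fun i : Fin 3 => ⟨i.succ, Fin.succ_ne_zero i⟩) fun i j hij => by simpa using hij
  let b : Module.Basis (Fin 3) ℝ (Fin 3 → ℝ) :=
    basisOfLinearIndependentOfCardEqFinrank hlin (by simp)
  have hb : ∀ i, b i = v i.succ - v 0 := fun i => by simp [b]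
  have hbi : ∀ i, b i ∈ integerPoints 3 := fun i => by
    rw [hb]
    exact (integerSubgroup 3).sub_mem (hv _) (hv _)
  have hconv := convexHull_range_eq_vadd_cornerSimplex v b hb
  have hbd : Bornology.IsBounded (cornerSimplex b 1) := by
    have := (bounded_convexHull_range v).vadd (-v 0)
    rwa [hconv, neg_vadd_vadd] at this
  obtain ⟨K, hK⟩ := cornerSimplex_relation b hbi hbd hn
  refine ⟨K, ?_⟩
  have hn0 : (0 : ℝ) < n := by exact_mod_cast hn
  have e1 : (n : ℝ) • (v 0 +ᵥ cornerSimplex b 1) = ((n : ℝ) • v 0) +ᵥ cornerSimplex b n := by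
    have := smul_cornerSimplex b hn0 1
    rw [mul_one] at this
    rw [← this, ← Set.singleton_vadd, ← Set.singleton_vadd, vadd_eq_add, vadd_eq_add, smul_add,
      Set.smul_set_singleton]
  have e2 : -(v 0 +ᵥ cornerSimplex b 1) = (-v 0) +ᵥ -cornerSimplex b 1 := by
    rw [← Set.singleton_vadd, ← Set.singleton_vadd, vadd_eq_add, vadd_eq_add, neg_add,
      Set.neg_singleton]
  have hnv : (n : ℝ) • v 0 ∈ integerPoints 3 := by
    rw [Nat.cast_smul_eq_nsmul]
    exact (integerSubgroup 3).nsmul_mem (hv 0) n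
  have hv' : -v 0 ∈ integerPoints 3 := (integerSubgroup 3).neg_mem (hv 0)
  filter_upwards [hK] with x hx
  rw [hconv, e1, e2, latticeCount_vadd hnv, latticeCount_vadd (hv 0), latticeCount_vadd hv', hx]

end Simplex

/-! ### From simplices to polytopes, and integrability. -/

section Polytope

open MeasureTheory

variable {d : ℕ}

/-- An integer polytope is the convex hull of a finite family of integer points. -/
lemma IsIntegerPolytope.exists_convexHull_range {P : Set (Fin d → ℝ)} (hP : IsIntegerPolytope P) :
    ∃ V : Finset (Fin d → ℝ), (∀ v ∈ V, v ∈ integerPoints d) ∧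
      P = convexHull ℝ (Set.range fun v : V => (v : Fin d → ℝ)) := by
  obtain ⟨⟨S, hS, rfl⟩, hV⟩ := hP
  have hfin : ((convexHull ℝ S).extremePoints ℝ).Finite := hS.subset extremePoints_convexHull_subset
  refine ⟨hfin.toFinset, fun v hv => hV (by simpa using hv), ?_⟩
  -- Krein–Milman; the closure is superfluous because there are finitely many extreme points.
  have hKM := closure_convexHull_extremePoints (hS.isCompact_convexHull ℝ) (convex_convexHull ℝ S)
  rw [(hfin.isCompact_convexHull ℝ).isClosed.closure_eq] at hKM
  have hr : Set.range (fun v : hfin.toFinset => (v : Fin d → ℝ)) =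
      (convexHull ℝ S).extremePoints ℝ := by
    ext v
    simp
  rw [hr, hKM]

/-- Almost-everywhere additivity of the lattice count under dilated almost-disjoint
decompositions. -/
lemma ae_latticeCount_smul_eq_sum {κ : Type*} {𝒯 : Finset κ} {C : Set (Fin d → ℝ)}
    {D : κ → Set (Fin d → ℝ)} {N : Set (Fin d → ℝ)} (hN : volume N = 0)
    (hD : ∀ t ∈ 𝒯, Bornology.IsBounded (D t))
    (hcov : ∀ y ∉ N, (y ∈ C ↔ ∃ t ∈ 𝒯, y ∈ D t))
    (hdisj : ∀ y ∉ N, ∀ s ∈ 𝒯, ∀ t ∈ 𝒯, y ∈ D s → y ∈ D t → s = t) {c : ℝ} (hc : c ≠ 0) :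
    ∀ᵐ x, latticeCount (c • C) x = ∑ t ∈ 𝒯, latticeCount (c • D t) x := by
  classical
  have hN' : volume (c • N) = 0 := by rw [Measure.addHaar_smul, hN, mul_zero]
  filter_upwards [ae_forall_integerPoints_sub_notMem hN'] with x hx
  have hx' : ∀ u ∈ integerPoints d, c⁻¹ • (u - x) ∉ N := fun u hu h =>
    hx u hu ((Set.mem_smul_set_iff_inv_smul_mem₀ hc _ _).2 h)
  have hfin : ∀ t ∈ 𝒯, (shiftedPoints (c • D t) x).Finite := fun t ht =>
    finite_shiftedPoints ((hD t ht).smul₀ c) x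
  have hU : shiftedPoints (c • C) x = ⋃ t ∈ 𝒯, shiftedPoints (c • D t) x := by
    ext u
    simp only [shiftedPoints, Set.mem_ofPred_eq, Set.mem_iUnion,
      Set.mem_smul_set_iff_inv_smul_mem₀ hc]
    constructor
    · rintro ⟨hu, huC⟩
      obtain ⟨t, ht, h⟩ := (hcov _ (hx' u hu)).1 huC
      exact ⟨t, ht, hu, h⟩
    · rintro ⟨t, ht, hu, h⟩
      exact ⟨hu, (hcov _ (hx' u hu)).2 ⟨t, ht, h⟩⟩
  simp only [latticeCount_eq_ncard]
  rw [hU, ← finsum_mem_coe_finset]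
  refine 𝒯.finite_toSet.ncard_biUnion hfin fun s hs t ht hst => ?_
  refine Set.disjoint_left.2 fun u hus hut => hst ?_
  have h1 := (Set.mem_smul_set_iff_inv_smul_mem₀ hc _ _).1 hus.2
  have h2 := (Set.mem_smul_set_iff_inv_smul_mem₀ hc _ _).1 hut.2
  exact hdisj _ (hx' u hus.1) s hs t ht h1 h2

theorem IsIntegerPolytope.latticeCount_relation {P : Set (Fin 3 → ℝ)} (hP : IsIntegerPolytope P)
    {n : ℕ} (hn : 0 < n) :
    ∃ K : ℝ, ∀ᵐ x, (latticeCount ((n : ℝ) • P) x : ℝ) =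
      n * (n + 1) / 2 * latticeCount P x - n * (n - 1) / 2 * latticeCount (-P) x + K := by
  obtain ⟨V, hV, rfl⟩ := hP.exists_convexHull_range
  set p : V → Fin 3 → ℝ := fun v => v with hp
  obtain ⟨𝒯, N, hN, h𝒯, hcov⟩ := exists_ae_triangulation volume p
  have hsimp : ∀ s ∈ 𝒯, ∃ K : ℝ, ∀ᵐ x, (latticeCount ((n : ℝ) • convexHull ℝ (p '' s)) x : ℝ) =
      n * (n + 1) / 2 * latticeCount (convexHull ℝ (p '' s)) x
        - n * (n - 1) / 2 * latticeCount (-convexHull ℝ (p '' s)) x + K := by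
    intro s hs
    obtain ⟨hcard, hind⟩ := h𝒯 s hs
    let e : s ≃ Fin 4 := s.equivFinOfCardEq (by rw [hcard]; simp)
    have hr : Set.range ((fun i : s => p i) ∘ e.symm) = p '' s := by
      rw [e.symm.surjective.range_comp]
      ext y
      simp
    have := latticeCount_simplex_relation (v := (fun i : s => p i) ∘ e.symm)
      (fun i => hV _ (e.symm i).1.2) (hind.comp_embedding e.symm.toEmbedding) hn
    rwa [hr] at this
  choose! K hK using hsimp
  have hbd : ∀ s ∈ 𝒯, Bornology.IsBounded (convexHull ℝ (p '' (s : Set V))) := fun s _ =>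
    isBounded_convexHull.2 ((Set.toFinite _).isBounded)
  -- One triangulation serves the scales `n`, `1` and `-1`, the last giving the reflection.
  have hdec : ∀ c : ℝ, c ≠ 0 → ∀ᵐ x, latticeCount (c • convexHull ℝ (Set.range p)) x =
      ∑ s ∈ 𝒯, latticeCount (c • convexHull ℝ (p '' (s : Set V))) x := fun c hc =>
    ae_latticeCount_smul_eq_sum hN hbd (fun y hy => (hcov y hy).1) (fun y hy => (hcov y hy).2) hc
  refine ⟨∑ s ∈ 𝒯, K s, ?_⟩
  have hneg : ∀ C : Set (Fin 3 → ℝ), (-1 : ℝ) • C = -C := fun C => by simp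
  filter_upwards [hdec n (by exact_mod_cast hn.ne'), hdec 1 one_ne_zero,
    hdec (-1) (by norm_num), (ae_ball_iff 𝒯.countable_toSet).2 hK] with x h1 h2 h3 h4
  simp only [one_smul, hneg] at h2 h3
  rw [h1, h2, h3]
  push_cast
  rw [Finset.mul_sum, Finset.mul_sum, ← Finset.sum_sub_distrib, ← Finset.sum_add_distrib]
  exact Finset.sum_congr rfl fun s hs => h4 s hs

/-- On bounded sets of translation vectors the lattice count of a compact set agrees with a bounded
measurable function. -/
lemma exists_measurable_bounded_eqOn_latticeCount {C B : Set (Fin d → ℝ)} (hC : IsCompact C)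
    (hB : Bornology.IsBounded B) :
    ∃ f : (Fin d → ℝ) → ℝ, Measurable f ∧ (∃ M, ∀ x, ‖f x‖ ≤ M) ∧
      ∀ x ∈ B, (latticeCount C x : ℝ) = f x := by
  classical
  have hfin := finite_integerPoints_inter (hC.isBounded.add hB)
  have hCm : MeasurableSet C := hC.isClosed.measurableSet
  -- For `x ∈ B` only integer points of `C + B` can contribute, so a fixed finite sum of indicators
  -- gives the count.
  refine ⟨fun x => ∑ u ∈ hfin.toFinset, C.indicator (fun _ => (1 : ℝ)) (u - x),
    Finset.measurable_sum _ fun u _ =>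
      (measurable_const.indicator hCm).comp (measurable_const.sub measurable_id),
    ⟨∑ _u ∈ hfin.toFinset, 1, fun x => (norm_sum_le _ _).trans (Finset.sum_le_sum fun u _ => ?_)⟩,
    fun x hx => ?_⟩
  · refine (norm_indicator_le_norm_self _ _).trans ?_
    simp
  · have hset : shiftedPoints C x = (hfin.toFinset.filter fun u => u - x ∈ C : Finset _) := by
      ext u
      simp only [shiftedPoints, Finset.coe_filter, Set.Finite.mem_toFinset, Set.mem_ofPred_eq,
        Set.mem_inter_iff]
      exact ⟨fun ⟨h1, h2⟩ => ⟨⟨h1, u - x, h2, x, hx, by simp⟩, h2⟩, fun h => ⟨h.1.1, h.2⟩⟩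
    rw [latticeCount_eq_ncard, hset, Set.ncard_coe_finset, Finset.card_filter]
    push_cast
    simp [Set.indicator_apply]

lemma integrable_latticeCount_comp {Ω : Type*} [MeasurableSpace Ω] {μ : Measure Ω}
    [IsFiniteMeasure μ] {X : Ω → Fin d → ℝ} (hX : AEMeasurable X μ) {C B : Set (Fin d → ℝ)}
    (hC : IsCompact C) (hB : Bornology.IsBounded B) (hXB : ∀ᵐ ω ∂μ, X ω ∈ B) :
    Integrable (fun ω => (latticeCount C (X ω) : ℝ)) μ := by
  obtain ⟨f, hf, ⟨M, hM⟩, hfC⟩ := exists_measurable_bounded_eqOn_latticeCount hC hB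
  have hint : Integrable (fun ω => f (X ω)) μ :=
    Integrable.of_bound (hf.comp_aemeasurable hX).aestronglyMeasurable M
      (Filter.Eventually.of_forall fun ω => hM _)
  refine hint.congr ?_
  filter_upwards [hXB] with ω hω
  exact (hfC _ hω).symm

end Polytope

/-! ### Transfer to the random translation. -/

theorem mainTheorem5 {Ω : Type*} [MeasurableSpace Ω] (μ : MeasureTheory.Measure Ω)
    [MeasureTheory.IsProbabilityMeasure μ] (X : Ω → (Fin 3 → ℝ))
    (hX : MeasureTheory.pdf.IsUniform X (Set.Icc (0 : Fin 3 → ℝ) 1) μ MeasureTheory.volume)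
    (P : Set (Fin 3 → ℝ)) (hP : IsIntegerPolytope P) (n : ℕ) (hn : 0 < n) :
    EqUpToConst μ
      (fun ω => (latticeCount ((n : ℝ) • P) (X ω) : ℝ))
      (fun ω => (n : ℝ) * ((n : ℝ) + 1) / 2 * (latticeCount P (X ω) : ℝ)
        - (n : ℝ) * ((n : ℝ) - 1) / 2 * (latticeCount (-P) (X ω) : ℝ)) := by
  have hvol : MeasureTheory.volume (Set.Icc (0 : Fin 3 → ℝ) 1) = 1 := by
    rw [Real.volume_Icc_pi]
    simp
  have hXm : AEMeasurable X μ :=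
    MeasureTheory.pdf.IsUniform.aemeasurable (by rw [hvol]; simp) (by rw [hvol]; simp) hX
  have hXI : ∀ᵐ ω ∂μ, X ω ∈ Set.Icc (0 : Fin 3 → ℝ) 1 := by
    refine MeasureTheory.ae_of_ae_map hXm (p := fun x => x ∈ Set.Icc (0 : Fin 3 → ℝ) 1) ?_
    rw [show μ.map X = _ from hX]
    exact ProbabilityTheory.ae_cond_mem measurableSet_Icc
  have hPc : IsCompact P := by
    obtain ⟨⟨S, hS, rfl⟩, -⟩ := hP
    exact hS.isCompact_convexHull ℝ
  have hB : Bornology.IsBounded (Set.Icc (0 : Fin 3 → ℝ) 1) := Metric.isBounded_Icc 0 1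
  have hint : ∀ {C : Set (Fin 3 → ℝ)}, IsCompact C →
      MeasureTheory.Integrable (fun ω => (latticeCount C (X ω) : ℝ)) μ := fun hC =>
    integrable_latticeCount_comp hXm hC hB hXI
  have hY := hint (hPc.smul (n : ℝ))
  have hZ : MeasureTheory.Integrable (fun ω =>
        (n : ℝ) * ((n : ℝ) + 1) / 2 * (latticeCount P (X ω) : ℝ)
        - (n : ℝ) * ((n : ℝ) - 1) / 2 * (latticeCount (-P) (X ω) : ℝ)) μ :=
    ((hint hPc).const_mul ((n : ℝ) * ((n : ℝ) + 1) / 2)).sub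
    ((hint hPc.neg).const_mul ((n : ℝ) * ((n : ℝ) - 1) / 2))
  refine ⟨hY, hZ, ?_⟩
  obtain ⟨K, hK⟩ := hP.latticeCount_relation hn
  -- The uniform law is absolutely continuous, so the volume-almost-everywhere relation holds almost
  -- surely at `X`; its expectation then identifies `K` as the difference of the means.
  have hrel := MeasureTheory.ae_of_ae_map hXm (hX.absolutelyContinuous.ae_le hK)
  have hmean := MeasureTheory.integral_congr_ae hrel
  rw [MeasureTheory.integral_add hZ (MeasureTheory.integrable_const K)] at hmean
  simp only [MeasureTheory.integral_const, MeasureTheory.probReal_univ, one_smul] at hmean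
  filter_upwards [hrel] with ω hω
  rw [hω, hmean]
  ring
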